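/- Call a sequence $\langle f_n\rangle$ of complex polynomials weakly convergent to the formal power series $f=\sum_k c_kz^k$ if $\lim_{n\to\infty}f_n^{(k)}(0)=k!\,c_k$ for every integer $k\ge 0$. The genus of an entire function $g\not\equiv 0$ is the least integer $h\ge 0$ such that $$g(z)=z^m e^{Q(z)}\prod_j\left(1-\frac z{a_j}\right)\exp\left(\sum_{k=1}^{h}\frac1k\left(\frac z{a_j}\right)^k\right)\qquad(z\in\mathbb C)$$ with an integer $m\ge 0$, a polynomial $Q$ of degree at most $h$, and finitely or countably many $a_j\in\mathbb C\setminus\{0\}$ with $\sum_j|a_j|^{-(h+1)}<\infty$ (and it is $\infty$ if there is no such $h$). For an entire function $\varphi$ let $\mathcal Z(\varphi)$ be the set of its zeros, with $\mathcal Z(\varphi)=\emptyset$ if $\varphi\equiv 0$. **Theorem 2.4.** Let $p$ be a positive integer and let $\langle f_n\rangle$ be a sequence of complex polynomials that converges weakly to the formal power series $f$. Suppose that $\lim_{n\to\infty}f_n(0)\neq 0$ and that for every $n$ all $z\in\mathcal Z(f_n)$ satisfy $\operatorname{Re}(z^p)\ge 0$. Then $f$ has infinite radius of convergence, so that it represents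 an entire function, again denoted by $f$; $f_n\to f$ uniformly on compact subsets of $\mathbb C$; all $z\in\mathcal Z(f)$ satisfy $\operatorname{Re}(z^p)\ge 0$; and $f$ is of the form $$f(z)=e^{\alpha z^{2p}}g(z)\qquad(z\in\mathbb C),$$ where $\alpha\in\mathbb C$ is a constant and $g$ is an entire function of genus at most $2p-1$. -/

import Mathlib

open Filter Topology

noncomputable section

/-- The zero set of a complex function; by convention it is empty when the function vanishes
identically. -/
def zeroSet (f : ℂ → ℂ) : Set ℂ := {z | f ≠ 0 ∧ f z = 0}

/-- The set of all complex `z` such that `z ^ p` lies in the closed right half plane. -/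
def rightHalfPlaneRoot (p : ℕ) : Set ℂ := {z | 0 ≤ (z ^ p).re}

/-- The sequence `F` of polynomials converges weakly to the formal power series `f`: for every `k`
the sequence of `k`-th derivatives at `0` converges, and its limit divided by `k!` is the `k`-th
coefficient of `f`. -/
def WeaklyConverges (F : ℕ → Polynomial ℂ) (f : PowerSeries ℂ) : Prop :=
  ∀ k : ℕ, Tendsto (fun n => iteratedDeriv k (fun z : ℂ => (F n).eval z) 0) atTop
    (𝓝 ((k.factorial : ℂ) * PowerSeries.coeff k f))

/-- The function `φ` is the sum of the formal power series `f` on the whole plane (so the radius of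
convergence of `f` is infinite and `φ` is entire). -/
def Represents (f : PowerSeries ℂ) (φ : ℂ → ℂ) : Prop :=
  Differentiable ℂ φ ∧ ∀ z : ℂ, HasSum (fun k : ℕ => PowerSeries.coeff k f * z ^ k) (φ z)

/-- Uniform convergence on all compact subsets of the complex plane. -/
def StronglyConverges (F : ℕ → ℂ → ℂ) (φ : ℂ → ℂ) : Prop :=
  ∀ K : Set ℂ, IsCompact K → TendstoUniformlyOn F φ atTop K

/-- The Weierstrass elementary factor `(1 - w) exp (w + w ^ 2 / 2 + ⋯ + w ^ h / h)`. -/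
def elementaryFactor (h : ℕ) (w : ℂ) : ℂ :=
  (1 - w) * Complex.exp (∑ k ∈ Finset.Icc 1 h, w ^ k / (k : ℂ))

/-- `g` has a Hadamard product of rank and degree at most `h`:
`g z = z ^ m * exp (Q z) * ∏ i, E_h (z / a i)` for all `z`, where `Q` is a polynomial of degree at
most `h` and `a` is a finite or countably infinite family of nonzero complex numbers such that
`∑ i, |a i| ^ (-(h + 1))` converges. -/
def HasHadamardProduct (g : ℂ → ℂ) (h : ℕ) : Prop :=
  ∃ (m : ℕ) (Q : Polynomial ℂ) (ι : Type) (_ : Countable ι) (a : ι → ℂ),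
    Q.natDegree ≤ h ∧ (∀ i, a i ≠ 0) ∧ Summable (fun i => (‖a i‖ ^ (h + 1))⁻¹) ∧
    ∀ z : ℂ, ∃ P : ℂ, HasProd (fun i => elementaryFactor h (z / a i)) P ∧
      g z = z ^ m * Complex.exp (Q.eval z) * P

/-- The genus of an entire function: the least `h` for which it has a Hadamard product as in
`HasHadamardProduct`, and `⊤` if there is none. -/
def genus (g : ℂ → ℂ) : ℕ∞ := ⨅ (h : ℕ) (_ : HasHadamardProduct g h), (h : ℕ∞)

end

/-
Let `b` run through the inverse roots of one of the polynomials and let `S_k = ∑ b ^ k`. Each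
`w = b ^ p` has nonnegative real part, so `|w| ^ 2 = 2 * (Re w) ^ 2 - Re (w ^ 2)` gives
`∑ |b| ^ (2 * p) ≤ 2 * |S_p| ^ 2 + |S_(2p)|`. By Newton's identities the power sums converge along
the sequence, so this bound is uniform in `n`. It bounds the polynomials on every disc, hence yields
the entire limit. Once the inverse roots are sorted by decreasing modulus, it also gives
`|b_j| ^ (2 * p) ≤ M / (j + 1)`, which is enough to pass to the limit in the canonical products of
rank `2 * p` along a subsequence. Part of the mass of `∑ b ^ (2 * p)` may escape in the limit, and
this is what the factor `exp (α * z ^ (2 * p))` accounts for.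
-/

open Polynomial

section ElementaryFactor

theorem elementaryFactor_succ (h : ℕ) (w : ℂ) :
    elementaryFactor (h + 1) w =
      elementaryFactor h w * Complex.exp (w ^ (h + 1) / ((h + 1 : ℕ) : ℂ)) := by
  rw [elementaryFactor, elementaryFactor, Finset.sum_Icc_succ_top (by lia), Complex.exp_add,
    mul_assoc]

theorem elementaryFactor_zero (h : ℕ) : elementaryFactor h 0 = 1 := by
  induction h with
  | zero => simp [elementaryFactor]
  | succ h ih => simp [elementaryFactor_succ, ih]

theorem elementaryFactor_ne_zero {h : ℕ} {w : ℂ} (hw : w ≠ 1) : elementaryFactor h w ≠ 0 :=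
  mul_ne_zero (sub_ne_zero.2 hw.symm) (Complex.exp_ne_zero _)

theorem hasDerivAt_elementaryFactor (h : ℕ) (w : ℂ) :
    HasDerivAt (elementaryFactor h)
      (-w ^ h * Complex.exp (∑ k ∈ Finset.Icc 1 h, w ^ k / (k : ℂ))) w := by
  induction h with
  | zero =>
    have hE : elementaryFactor 0 = fun w => 1 - w := by ext; simp [elementaryFactor]
    simpa [hE] using (hasDerivAt_id w).const_sub 1
  | succ h ih =>
    have hpow : HasDerivAt (fun w : ℂ => w ^ (h + 1) / ((h + 1 : ℕ) : ℂ)) (w ^ h) w := by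
      have := (hasDerivAt_pow (h + 1) w).div_const ((h + 1 : ℕ) : ℂ)
      rwa [mul_div_cancel_left₀ _ (Nat.cast_ne_zero.2 h.succ_ne_zero)] at this
    rw [funext (elementaryFactor_succ h)]
    refine (ih.mul hpow.cexp).congr_deriv ?_
    rw [Finset.sum_Icc_succ_top (by lia), Complex.exp_add, elementaryFactor]
    ring

theorem continuous_elementaryFactor (h : ℕ) : Continuous (elementaryFactor h) :=
  continuous_iff_continuousAt.2 fun w => (hasDerivAt_elementaryFactor h w).continuousAt

theorem exists_norm_elementaryFactor_sub_one_le (h : ℕ) (R : ℝ) :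
    ∃ C, 0 ≤ C ∧ ∀ w : ℂ, ‖w‖ ≤ R → ‖elementaryFactor h w - 1‖ ≤ C * ‖w‖ ^ (h + 1) := by
  set C := Real.exp (∑ k ∈ Finset.Icc 1 h, R ^ k / (k : ℝ))
  refine ⟨C, (Real.exp_pos _).le, fun w hw => ?_⟩
  have hderiv : ∀ x ∈ Metric.closedBall (0 : ℂ) ‖w‖,
      ‖-x ^ h * Complex.exp (∑ k ∈ Finset.Icc 1 h, x ^ k / (k : ℂ))‖ ≤ C * ‖w‖ ^ h := by
    intro x hx
    rw [mem_closedBall_zero_iff] at hx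
    have hexp : ‖Complex.exp (∑ k ∈ Finset.Icc 1 h, x ^ k / (k : ℂ))‖ ≤ C := by
      refine (Complex.norm_exp_le_exp_norm _).trans (Real.exp_le_exp.2 ?_)
      refine norm_sum_le_of_le _ fun k _ => ?_
      rw [norm_div, norm_pow, Complex.norm_natCast]
      gcongr
      exact hx.trans hw
    rw [norm_mul, norm_neg, norm_pow, mul_comm]
    gcongr
  have := (convex_closedBall (0 : ℂ) ‖w‖).norm_image_sub_le_of_norm_hasDerivWithin_le
    (x := 0) (y := w) (fun x _ => (hasDerivAt_elementaryFactor h x).hasDerivWithinAt)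
    hderiv (by simp) (by simp)
  rwa [elementaryFactor_zero, sub_zero, mul_assoc, ← pow_succ] at this

theorem exists_norm_elementaryFactor_mul_sub_one_le (h : ℕ) (R B : ℝ) :
    ∃ C, 0 ≤ C ∧ ∀ z w : ℂ, ‖z‖ ≤ R → ‖w‖ ≤ B →
      ‖elementaryFactor h (z * w) - 1‖ ≤ C * ‖w‖ ^ (h + 1) := by
  obtain ⟨C, hC₀, hC⟩ := exists_norm_elementaryFactor_sub_one_le h (R * B)
  refine ⟨C * |R| ^ (h + 1), by positivity, fun z w hz hw => ?_⟩
  have hzw : ‖z * w‖ ≤ R * B := by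
    rw [norm_mul]
    exact mul_le_mul hz hw (norm_nonneg _) ((norm_nonneg _).trans hz)
  refine (hC _ hzw).trans ?_
  rw [norm_mul, mul_pow, ← mul_assoc]
  gcongr
  exact hz.trans (le_abs_self R)

theorem prod_one_sub_eq_exp_mul_prod_elementaryFactor {ι : Type*} (h : ℕ) (s : Finset ι)
    (w : ι → ℂ) :
    ∏ j ∈ s, (1 - w j) =
      Complex.exp (-∑ k ∈ Finset.Icc 1 h, (∑ j ∈ s, w j ^ k) / (k : ℂ)) *
        ∏ j ∈ s, elementaryFactor h (w j) := by
  simp only [elementaryFactor, Finset.prod_mul_distrib, ← Complex.exp_sum, Finset.sum_div]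
  rw [Finset.sum_comm, mul_left_comm, ← Complex.exp_add, neg_add_cancel, Complex.exp_zero, mul_one]

end ElementaryFactor

section CanonicalProduct

variable {ι : Type*} {h : ℕ} {β : ι → ℂ}

/-- The canonical product of rank `h`, indexed by the reciprocals `β j` of its zeros, so that
passing to a limit in which a zero escapes to infinity amounts to `β j = 0`. -/
noncomputable def canonicalProduct (h : ℕ) (β : ι → ℂ) (z : ℂ) : ℂ :=
  ∏' j, elementaryFactor h (z * β j)

theorem le_add_one_of_pow_le {x M : ℝ} {q : ℕ} (hq : q ≠ 0) (hx : 0 ≤ x) (hM : x ^ q ≤ M) :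
    x ≤ M + 1 := by
  rcases le_total x 1 with hx1 | hx1
  · linarith [pow_nonneg hx q]
  · linarith [le_self_pow₀ hx1 hq]

theorem norm_le_add_one_of_sum_norm_pow_le {q : ℕ} {M : ℝ} (hq : q ≠ 0)
    (hM : ∀ s : Finset ι, ∑ j ∈ s, ‖β j‖ ^ q ≤ M) (j : ι) : ‖β j‖ ≤ M + 1 :=
  le_add_one_of_pow_le hq (norm_nonneg _) (by simpa using hM {j})

theorem summable_norm_elementaryFactor_sub_one (hβ : Summable fun j => ‖β j‖ ^ (h + 1)) (z : ℂ) :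
    Summable fun j => ‖elementaryFactor h (z * β j) - 1‖ := by
  have hbound := norm_le_add_one_of_sum_norm_pow_le h.succ_ne_zero
    fun s => hβ.sum_le_tsum s fun _ _ => by positivity
  obtain ⟨C, -, hC⟩ := exists_norm_elementaryFactor_mul_sub_one_le h ‖z‖ _
  exact (hβ.mul_left C).of_nonneg_of_le (fun _ => norm_nonneg _)
    fun j => hC z (β j) le_rfl (hbound j)

theorem hasProd_canonicalProduct (hβ : Summable fun j => ‖β j‖ ^ (h + 1)) (z : ℂ) :
    HasProd (fun j => elementaryFactor h (z * β j)) (canonicalProduct h β z) := by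
  have := multipliable_one_add_of_summable (summable_norm_elementaryFactor_sub_one hβ z)
  simp only [add_sub_cancel] at this
  exact this.hasProd

theorem exists_norm_canonicalProduct_le (h : ℕ) (R M : ℝ) :
    ∃ B, ∀ β : ι → ℂ, (∀ s : Finset ι, ∑ j ∈ s, ‖β j‖ ^ (h + 1) ≤ M) →
      ∀ z : ℂ, ‖z‖ ≤ R → ‖canonicalProduct h β z‖ ≤ B := by
  obtain ⟨C, hC₀, hC⟩ := exists_norm_elementaryFactor_mul_sub_one_le h R (M + 1)
  refine ⟨Real.exp (C * M), fun β hM z hz => ?_⟩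
  have hβ : Summable fun j => ‖β j‖ ^ (h + 1) :=
    summable_of_sum_le (fun _ => by positivity) hM
  refine le_of_tendsto (hasProd_canonicalProduct hβ z).norm (Eventually.of_forall fun s => ?_)
  have hsum : ∑ j ∈ s, ‖elementaryFactor h (z * β j) - 1‖ ≤ C * M := by
    calc ∑ j ∈ s, ‖elementaryFactor h (z * β j) - 1‖ ≤ ∑ j ∈ s, C * ‖β j‖ ^ (h + 1) :=
          Finset.sum_le_sum fun j _ =>
            hC z (β j) hz (norm_le_add_one_of_sum_norm_pow_le h.succ_ne_zero hM j)
      _ ≤ C * M := by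
          rw [← Finset.mul_sum]
          gcongr
          exact hM s
  have hprod := s.norm_prod_one_add_sub_one_le fun j => elementaryFactor h (z * β j) - 1
  simp only [add_sub_cancel] at hprod
  have htri := norm_sub_norm_le (∏ j ∈ s, elementaryFactor h (z * β j)) 1
  rw [norm_one] at htri
  simp only [← norm_prod]
  linarith [Real.exp_le_exp.2 hsum]

theorem tendsto_canonicalProduct {α : Type*} {l : Filter α} {b : α → ι → ℂ} {bound : ι → ℝ}
    (hbound : Summable bound) (hle : ∀ n j, ‖b n j‖ ^ (h + 1) ≤ bound j)
    (hb : ∀ j, Tendsto (fun n => b n j) l (𝓝 (β j))) (z : ℂ) :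
    Tendsto (fun n => canonicalProduct h (b n) z) l (𝓝 (canonicalProduct h β z)) := by
  have hnorm : ∀ n j, ‖b n j‖ ≤ ∑' i, bound i + 1 := fun n j =>
    le_add_one_of_pow_le h.succ_ne_zero (norm_nonneg _) <| (hle n j).trans <|
      hbound.le_tsum j fun i _ => (by positivity : 0 ≤ ‖b n i‖ ^ (h + 1)).trans (hle n i)
  obtain ⟨C, hC₀, hC⟩ := exists_norm_elementaryFactor_mul_sub_one_le h ‖z‖ (∑' i, bound i + 1)
  have := tendsto_tprod_one_add_of_dominated_convergence (hbound.mul_left C)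
    (fun j => (((continuous_elementaryFactor h).tendsto _).comp ((hb j).const_mul z)).sub_const 1)
    (Eventually.of_forall fun n j => (hC z (b n j) le_rfl (hnorm n j)).trans
      (mul_le_mul_of_nonneg_left (hle n j) hC₀))
  simpa only [canonicalProduct, Function.comp_apply, add_sub_cancel] using this

theorem canonicalProduct_ne_zero (hβ : Summable fun j => ‖β j‖ ^ (h + 1)) {z : ℂ}
    (hz : ∀ j, z * β j ≠ 1) : canonicalProduct h β z ≠ 0 := by
  have := tprod_one_add_ne_zero_of_summable
    (fun j => by simpa only [add_sub_cancel] using elementaryFactor_ne_zero (h := h) (hz j))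
    (summable_norm_elementaryFactor_sub_one hβ z)
  simpa only [canonicalProduct, add_sub_cancel] using this

theorem canonicalProduct_succ (hβ : Summable fun j => ‖β j‖ ^ (h + 1)) (z : ℂ) :
    canonicalProduct (h + 1) β z =
      Complex.exp ((∑' j, β j ^ (h + 1)) / ((h + 1 : ℕ) : ℂ) * z ^ (h + 1)) *
        canonicalProduct h β z := by
  have hsum : Summable fun j => β j ^ (h + 1) := .of_norm (by simpa only [norm_pow] using hβ)
  have hexp := ((hsum.hasSum.div_const ((h + 1 : ℕ) : ℂ)).mul_right (z ^ (h + 1))).cexp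
  rw [mul_comm, ← ((hasProd_canonicalProduct hβ z).mul hexp).tprod_eq, canonicalProduct]
  refine tprod_congr fun j => ?_
  rw [elementaryFactor_succ, mul_pow, Function.comp, mul_comm (z ^ (h + 1)), mul_div_right_comm]

theorem canonicalProduct_succ_ne_zero (hβ : Summable fun j => ‖β j‖ ^ (h + 1)) {z : ℂ}
    (hz : ∀ j, z * β j ≠ 1) : canonicalProduct (h + 1) β z ≠ 0 := by
  rw [canonicalProduct_succ hβ]
  exact mul_ne_zero (Complex.exp_ne_zero _) (canonicalProduct_ne_zero hβ hz)

theorem genus_le_of_hasHadamardProduct {g : ℂ → ℂ} {h : ℕ} (hg : HasHadamardProduct g h) :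
    genus g ≤ h :=
  iInf₂_le h hg

theorem hasHadamardProduct_exp_mul_canonicalProduct {ι : Type} [Countable ι] {β : ι → ℂ}
    (hβ : Summable fun j => ‖β j‖ ^ (h + 1)) {Q : ℂ[X]} (hQ : Q.natDegree ≤ h) :
    HasHadamardProduct (fun z => Complex.exp (Q.eval z) * canonicalProduct h β z) h := by
  refine ⟨0, Q, {j // β j ≠ 0}, inferInstance, fun j => (β j)⁻¹, hQ, fun j => inv_ne_zero j.2, ?_,
    fun z => ⟨canonicalProduct h β z, ?_, by rw [pow_zero, one_mul]⟩⟩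
  · simpa only [norm_inv, inv_pow, inv_inv, Function.comp_def] using
      hβ.comp_injective Subtype.val_injective
  · have hsupport : Function.mulSupport (fun j => elementaryFactor h (z * β j)) ⊆ {j | β j ≠ 0} :=
      fun j hj hj₀ => hj (by simp only [hj₀, mul_zero, elementaryFactor_zero])
    simp only [div_inv_eq_mul]
    exact (hasProd_subtype_iff_of_mulSupport_subset hsupport).2 (hasProd_canonicalProduct hβ z)

/-- The top-degree term of the exponent and the factor `exp ((z / a) ^ (h + 1) / (h + 1))` by which
elementary factors of consecutive ranks differ both go into `exp (α * z ^ (h + 1))`. -/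
theorem exists_exp_mul_hasHadamardProduct {ι : Type} [Countable ι] {β : ι → ℂ}
    (hβ : Summable fun j => ‖β j‖ ^ (h + 1)) {Q : ℂ[X]} (hQ : Q.natDegree ≤ h + 1) :
    ∃ (α : ℂ) (g : ℂ → ℂ), HasHadamardProduct g h ∧
      ∀ z, Complex.exp (Q.eval z) * canonicalProduct (h + 1) β z =
        Complex.exp (α * z ^ (h + 1)) * g z := by
  set Q₀ := Q - C (Q.coeff (h + 1)) * X ^ (h + 1) with hQ₀
  have hdeg : Q₀.natDegree ≤ h := by
    refine natDegree_le_iff_coeff_eq_zero.2 fun k hk => ?_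
    rw [hQ₀, coeff_sub, coeff_C_mul_X_pow]
    split_ifs with hkh
    · rw [hkh, sub_self]
    · rw [coeff_eq_zero_of_natDegree_lt (by lia), sub_zero]
  refine ⟨Q.coeff (h + 1) + (∑' j, β j ^ (h + 1)) / ((h + 1 : ℕ) : ℂ), _,
    hasHadamardProduct_exp_mul_canonicalProduct hβ hdeg, fun z => ?_⟩
  have hQz : Q.eval z = Q.coeff (h + 1) * z ^ (h + 1) + Q₀.eval z := by simp [hQ₀]
  rw [canonicalProduct_succ hβ, hQz, add_mul, Complex.exp_add, Complex.exp_add]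
  ring

end CanonicalProduct

section InverseRoots

open Finset.HasAntidiagonal (antidiagonal mem_antidiagonal)

/-- `b` lists the reciprocals of the roots of `P`, with multiplicity. The index type may exceed the
degree, the family being padded with zeros, so that polynomials of any degree can share it. -/
def HasInverseRoots {ι R : Type*} [CommRing R] (P : R[X]) (b : ι →₀ R) : Prop :=
  P = C (P.coeff 0) * ∏ j ∈ b.support, (1 - C (b j) * X)

/-- The power sum `∑ j, b j ^ k`. The sum runs over the support of `b`, so its value for `k = 0` is
the number of nonzero terms. -/
def powerSum {ι R : Type*} [CommRing R] (b : ι →₀ R) (k : ℕ) : R :=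
  ∑ j ∈ b.support, b j ^ k

theorem coeff_prod_one_sub_C_mul_X {σ R : Type*} [Fintype σ] [CommRing R] (w : σ → R) (k : ℕ) :
    (∏ i, (1 - C (w i) * X)).coeff k =
      (-1) ^ k * MvPolynomial.aeval w (MvPolynomial.esymm σ R k) := by
  have hterm : ∀ t : Finset σ,
      ∏ i ∈ t, -(C (w i) * X) = C ((-1) ^ t.card * ∏ i ∈ t, w i) * X ^ t.card := fun t => by
    simp [Finset.prod_neg, Finset.prod_mul_distrib, mul_assoc]
  simp only [sub_eq_add_neg, Finset.prod_one_add, hterm, finsetSum_coeff, coeff_C_mul_X_pow,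
    MvPolynomial.esymm, map_sum, map_prod, MvPolynomial.aeval_X, Finset.mul_sum]
  rw [← Finset.sum_filter, Finset.powerset_univ, Finset.powersetCard_eq_filter,
    Finset.powerset_univ]
  refine Finset.sum_congr (Finset.filter_congr fun t _ => eq_comm) fun t ht => ?_
  rw [(Finset.mem_filter.1 ht).2]

namespace HasInverseRoots

theorem coeff_zero_mul_powerSum {ι R : Type*} [CommRing R] {P : R[X]} {b : ι →₀ R}
    (hb : HasInverseRoots P b) {k : ℕ} (hk : 0 < k) :
    P.coeff 0 * powerSum b k = -(k * P.coeff k) -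
      ∑ a ∈ antidiagonal k with a.1 ∈ Set.Ioo 0 k, P.coeff a.1 * powerSum b a.2 := by
  set w : b.support → R := fun i => b i
  have hcoeff : ∀ m, P.coeff m =
      P.coeff 0 * ((-1) ^ m * MvPolynomial.aeval w (MvPolynomial.esymm b.support R m)) := by
    intro m
    conv_lhs => rw [hb, coeff_C_mul, ← Finset.prod_coe_sort]
    rw [coeff_prod_one_sub_C_mul_X]
  have hpsum : ∀ m, powerSum b m = MvPolynomial.aeval w (MvPolynomial.psum b.support R m) :=
    fun m => by simp [powerSum, MvPolynomial.psum, w, Finset.sum_attach _ fun j => b j ^ m]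
  have newton := congrArg (MvPolynomial.aeval w)
    (MvPolynomial.psum_eq_mul_esymm_sub_sum b.support R k hk)
  simp only [map_sub, map_mul, map_pow, map_neg, map_one, map_natCast, map_sum, ← hpsum] at newton
  rw [newton, mul_sub, Finset.mul_sum, hcoeff k]
  congr 1
  · ring
  · refine Finset.sum_congr rfl fun a _ => ?_
    rw [hcoeff a.1]
    ring

theorem exists_tendsto_powerSum {α ι 𝕜 : Type*} [NormedField 𝕜] {l : Filter α} {F : α → 𝕜[X]}
    {b : α → ι →₀ 𝕜} (hb : ∀ n, HasInverseRoots (F n) (b n)) {c : ℕ → 𝕜}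
    (hF : ∀ k, Tendsto (fun n => (F n).coeff k) l (𝓝 (c k))) (hc : c 0 ≠ 0) {k : ℕ} (hk : 0 < k) :
    ∃ S, Tendsto (fun n => powerSum (b n) k) l (𝓝 S) := by
  induction k using Nat.strong_induction_on with
  | _ k ih =>
    choose! S hS using ih
    have hsum : Tendsto (fun n => ∑ a ∈ antidiagonal k with a.1 ∈ Set.Ioo 0 k,
        (F n).coeff a.1 * powerSum (b n) a.2) l
        (𝓝 (∑ a ∈ antidiagonal k with a.1 ∈ Set.Ioo 0 k, c a.1 * S a.2)) := by
      refine tendsto_finsetSum _ fun a ha => (hF a.1).mul ?_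
      simp only [Finset.mem_filter, mem_antidiagonal, Set.mem_Ioo] at ha
      exact hS a.2 (by lia) (by lia)
    refine ⟨_, Tendsto.congr' ?_ ((((hF k).const_mul (k : 𝕜)).neg.sub hsum).div (hF 0) hc)⟩
    filter_upwards [(hF 0).eventually_ne hc] with n hn
    rw [Pi.div_apply, ← (hb n).coeff_zero_mul_powerSum hk, mul_div_cancel_left₀ _ hn]

theorem eval_inv_eq_zero {ι K : Type*} [Field K] {P : K[X]} {b : ι →₀ K}
    (hb : HasInverseRoots P b) {j : ι} (hj : b j ≠ 0) : P.eval (b j)⁻¹ = 0 := by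
  rw [hb, eval_mul, eval_prod, Finset.prod_eq_zero (Finsupp.mem_support_iff.2 hj), mul_zero]
  simp [hj]

theorem eval_eq_exp_mul_canonicalProduct {ι : Type*} {P : ℂ[X]} {b : ι →₀ ℂ}
    (hb : HasInverseRoots P b) (h : ℕ) (z : ℂ) :
    P.eval z = P.coeff 0 * (Complex.exp (-∑ k ∈ Finset.Icc 1 h, powerSum b k / k * z ^ k) *
      canonicalProduct h b z) := by
  have heval : P.eval z = P.coeff 0 * ∏ j ∈ b.support, (1 - z * b j) := by
    conv_lhs => rw [hb]
    simp [eval_prod, mul_comm z]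
  have hprod : canonicalProduct h b z = ∏ j ∈ b.support, elementaryFactor h (z * b j) :=
    tprod_eq_prod fun j hj => by
      rw [Finsupp.notMem_support_iff.1 hj, mul_zero, elementaryFactor_zero]
  have hpow : ∀ k, ∑ j ∈ b.support, (z * b j) ^ k = powerSum b k * z ^ k := fun k => by
    simp only [powerSum, mul_pow, ← Finset.mul_sum, mul_comm]
  simp only [heval, hprod, prod_one_sub_eq_exp_mul_prod_elementaryFactor h, hpow,
    mul_div_right_comm]

end HasInverseRoots

theorem exists_antitone_norm_enumeration {E : Type*} [NormedAddCommGroup E] (s : Multiset E)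
    (hs : (0 : E) ∉ s) :
    ∃ b : ℕ →₀ E, Antitone (fun j => ‖b j‖) ∧ b.support.val.map b = s := by
  classical
  let r : E → E → Prop := fun x y => ‖y‖ ≤ ‖x‖
  have : Std.Total r := ⟨fun x y => le_total _ _⟩
  have : IsTrans E r := ⟨fun x y z hxy hyz => le_trans hyz hxy⟩
  set l := s.toList.insertionSort r
  have hl : (l : Multiset E) = s :=
    (Multiset.coe_eq_coe.2 (List.perm_insertionSort r _)).trans s.coe_toList
  have hsupport : l.toFinsupp.support = Finset.range l.length := by
    rw [List.toFinsupp_support, Finset.filter_true_of_mem]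
    intro j hj h₀
    rw [List.getD_eq_getElem _ _ (Finset.mem_range.1 hj)] at h₀
    exact hs (hl ▸ Multiset.mem_coe.2 (h₀ ▸ List.getElem_mem _))
  refine ⟨l.toFinsupp, fun i j hij => ?_, ?_⟩
  · dsimp only
    rcases lt_or_ge j l.length with hj | hj
    · rcases hij.eq_or_lt with rfl | hij
      · exact le_rfl
      rw [List.toFinsupp_apply_lt _ _ hj, List.toFinsupp_apply_lt _ _ (hij.trans hj)]
      exact List.pairwise_iff_getElem.1 (List.pairwise_insertionSort r _) i j _ hj hij
    · rw [List.toFinsupp_apply_le _ _ hj, norm_zero]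
      exact norm_nonneg _
  · rw [hsupport, Finset.range_val, ← Multiset.coe_range, Multiset.map_coe, ← hl]
    congr 1
    refine List.ext_getElem (by simp) fun i _ hi => ?_
    rw [List.getElem_map, List.getElem_range, List.toFinsupp_apply_lt _ _ hi]

theorem eq_C_coeff_zero_mul_prod_roots {K : Type*} [Field K] [IsAlgClosed K] {P : K[X]}
    (hP : P.coeff 0 ≠ 0) :
    P = C (P.coeff 0) * ((P.roots.map Inv.inv).map fun w => 1 - C w * X).prod := by
  have hfactor : ∀ z, P.eval z = P.leadingCoeff * (P.roots.map fun a => z - a).prod := fun z => by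
    conv_lhs => rw [(IsAlgClosed.splits P).eq_prod_roots]
    simp [eval_multiset_prod]
  refine Polynomial.funext fun z => ?_
  rw [coeff_zero_eq_eval_zero] at hP ⊢
  rw [eval_mul, eval_C, hfactor 0, hfactor z, eval_multiset_prod, Multiset.map_map,
    Multiset.map_map, mul_assoc, ← Multiset.prod_map_mul]
  congr 2
  refine Multiset.map_congr rfl fun a ha => ?_
  have ha₀ : a ≠ 0 := by
    rintro rfl
    exact hP (isRoot_of_mem_roots ha)
  simp only [Function.comp_apply, eval_sub, eval_one, eval_mul, eval_C, eval_X]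
  field_simp
  ring

theorem exists_antitone_hasInverseRoots {P : ℂ[X]} (hP : P.coeff 0 ≠ 0) :
    ∃ b : ℕ →₀ ℂ, Antitone (fun j => ‖b j‖) ∧ HasInverseRoots P b := by
  have h₀ : (0 : ℂ) ∉ P.roots.map Inv.inv := by
    simp only [Multiset.mem_map, inv_eq_zero, exists_eq_right]
    rw [coeff_zero_eq_eval_zero] at hP
    exact fun h => hP (isRoot_of_mem_roots h)
  obtain ⟨b, hanti, hb⟩ := exists_antitone_norm_enumeration _ h₀
  refine ⟨b, hanti, (eq_C_coeff_zero_mul_prod_roots hP).trans ?_⟩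
  rw [← hb, Multiset.map_map]
  rfl

end InverseRoots

section CoefficientwiseConvergence

theorem iteratedDeriv_eval (P : ℂ[X]) (k : ℕ) :
    iteratedDeriv k (fun z => P.eval z) = fun z => (derivative^[k] P).eval z := by
  induction k with
  | zero => simp
  | succ k ih =>
    funext z
    rw [iteratedDeriv_succ, ih, Polynomial.deriv, Function.iterate_succ_apply']

theorem iteratedDeriv_eval_zero (P : ℂ[X]) (k : ℕ) :
    iteratedDeriv k (fun z => P.eval z) 0 = k.factorial * P.coeff k := by
  rw [iteratedDeriv_eval]
  beta_reduce
  rw [← coeff_zero_eq_eval_zero, coeff_iterate_derivative, zero_add, Nat.descFactorial_self,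
    nsmul_eq_mul]

theorem WeaklyConverges.tendsto_coeff {F : ℕ → ℂ[X]} {f : PowerSeries ℂ}
    (hF : WeaklyConverges F f) (k : ℕ) :
    Tendsto (fun n => (F n).coeff k) atTop (𝓝 (PowerSeries.coeff k f)) := by
  have hk : (k.factorial : ℂ) ≠ 0 := Nat.cast_ne_zero.2 k.factorial_ne_zero
  simpa only [iteratedDeriv_eval_zero, inv_mul_cancel_left₀ hk] using
    (hF k).const_mul (k.factorial : ℂ)⁻¹

theorem WeaklyConverges.comp_add {F : ℕ → ℂ[X]} {f : PowerSeries ℂ} (hF : WeaklyConverges F f)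
    (m : ℕ) : WeaklyConverges (fun n => F (n + m)) f :=
  fun k => (hF k).comp (tendsto_add_atTop_nat m)

theorem WeaklyConverges.coeff_zero_eq {F : ℕ → ℂ[X]} {f : PowerSeries ℂ}
    (hF : WeaklyConverges F f) {c : ℂ} (hc : Tendsto (fun n => (F n).eval 0) atTop (𝓝 c)) :
    PowerSeries.coeff 0 f = c := by
  have h₀ := hF.tendsto_coeff 0
  simp only [coeff_zero_eq_eval_zero] at h₀
  exact tendsto_nhds_unique h₀ hc

theorem norm_taylorCoeff_mul_pow_le {g : ℂ → ℂ} (hg : Differentiable ℂ g) {r B : ℝ} (hr : 0 < r)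
    (hB : ∀ z, ‖z‖ ≤ r → ‖g z‖ ≤ B) (k : ℕ) :
    ‖(k.factorial : ℂ)⁻¹ * iteratedDeriv k g 0‖ * r ^ k ≤ B := by
  have hcauchy := Complex.norm_iteratedDeriv_le_of_forall_mem_sphere_norm_le k hr hg.diffContOnCl
    fun z hz => hB z (mem_sphere_zero_iff_norm.1 hz).le
  have hk : (0 : ℝ) < k.factorial := mod_cast k.factorial_pos
  rw [norm_mul, norm_inv, Complex.norm_natCast, ← le_div_iff₀ (by positivity), inv_mul_le_iff₀ hk,
    ← mul_div_assoc]
  exact hcauchy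

theorem tendstoUniformlyOn_iff_tendsto_sub {α X E : Type*} [SeminormedAddCommGroup E]
    {l : Filter α} {s : Set X} {U : α → X → E} {V : X → E} :
    TendstoUniformlyOn U V l s ↔
      Tendsto (fun a : α × X => U a.1 a.2 - V a.2) (l ×ˢ 𝓟 s) (𝓝 0) := by
  rw [tendstoUniformlyOn_iff_tendsto, uniformity_eq_comap_nhds_zero, tendsto_comap_iff]
  rfl

theorem tendstoUniformlyOn_of_hasSum_of_dominated {α κ X E : Type*} [NormedAddCommGroup E]
    [CompleteSpace E] {l : Filter α} {s : Set X} {u : α → κ → X → E} {v : κ → X → E}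
    {U : α → X → E} {V : X → E} {bound : κ → ℝ} (hbound : Summable bound)
    (hu : ∀ k, TendstoUniformlyOn (fun n => u n k) (v k) l s)
    (hle : ∀ n k, ∀ x ∈ s, ‖u n k x - v k x‖ ≤ bound k)
    (hU : ∀ n, ∀ x ∈ s, HasSum (fun k => u n k x) (U n x))
    (hV : ∀ x ∈ s, HasSum (fun k => v k x) (V x)) : TendstoUniformlyOn U V l s := by
  have hs : ∀ᶠ a : α × X in l ×ˢ 𝓟 s, a.2 ∈ s := tendsto_snd (mem_principal_self s)
  have hsum := tendsto_tsum_of_dominated_convergence hbound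
    (fun k => tendstoUniformlyOn_iff_tendsto_sub.1 (hu k)) (hs.mono fun a ha k => hle a.1 k a.2 ha)
  rw [tsum_zero] at hsum
  refine tendstoUniformlyOn_iff_tendsto_sub.2 (hsum.congr' (hs.mono fun a ha => ?_))
  exact ((hU a.1 a.2 ha).sub (hV a.2 ha)).tsum_eq

theorem tendstoUniformlyOn_closedBall_of_coeff {α : Type*} {l : Filter α} {a : α → ℕ → ℂ}
    {c : ℕ → ℂ} {U : α → ℂ → ℂ} {V : ℂ → ℂ} {R : ℝ} {bound : ℕ → ℝ} (hbound : Summable bound)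
    (ha : ∀ k, Tendsto (fun n => a n k) l (𝓝 (c k)))
    (hale : ∀ n k, ‖a n k‖ * R ^ k ≤ bound k) (hcle : ∀ k, ‖c k‖ * R ^ k ≤ bound k)
    (hU : ∀ n z, HasSum (fun k => a n k * z ^ k) (U n z))
    (hV : ∀ z, HasSum (fun k => c k * z ^ k) (V z)) :
    TendstoUniformlyOn U V l (Metric.closedBall 0 R) := by
  have hterm : ∀ n k, ∀ z ∈ Metric.closedBall (0 : ℂ) R,
      ‖a n k * z ^ k - c k * z ^ k‖ ≤ ‖a n k - c k‖ * R ^ k := fun n k z hz => by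
    rw [← sub_mul, norm_mul, norm_pow]
    gcongr
    exact mem_closedBall_zero_iff.1 hz
  refine tendstoUniformlyOn_of_hasSum_of_dominated (u := fun n k z => a n k * z ^ k)
    (hbound.add hbound) (fun k => Metric.tendstoUniformlyOn_iff.2 fun ε hε => ?_)
    (fun n k z hz => ?_) (fun n z _ => hU n z) (fun z _ => hV z)
  · have hlim := ((ha k).sub_const (c k)).norm.mul_const (R ^ k)
    rw [sub_self, norm_zero, zero_mul] at hlim
    filter_upwards [hlim.eventually_lt_const hε] with n hn z hz
    rw [dist_comm, dist_eq_norm]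
    exact (hterm n k z hz).trans_lt hn
  · have hR : 0 ≤ R := (norm_nonneg z).trans (mem_closedBall_zero_iff.1 hz)
    calc ‖a n k * z ^ k - c k * z ^ k‖ ≤ ‖a n k - c k‖ * R ^ k := hterm n k z hz
      _ ≤ (‖a n k‖ + ‖c k‖) * R ^ k := by
        gcongr
        exact norm_sub_le _ _
      _ ≤ bound k + bound k := by
        rw [add_mul]
        exact add_le_add (hale n k) (hcle k)

theorem StronglyConverges.tendsto {F : ℕ → ℂ → ℂ} {φ : ℂ → ℂ} (hF : StronglyConverges F φ)
    (z : ℂ) : Tendsto (fun n => F n z) atTop (𝓝 (φ z)) :=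
  (hF {z} isCompact_singleton).tendsto_at rfl

theorem StronglyConverges.of_add {F : ℕ → ℂ → ℂ} {φ : ℂ → ℂ} {m : ℕ}
    (hF : StronglyConverges (fun n => F (n + m)) φ) : StronglyConverges F φ := fun K hK u hu => by
  rw [← map_add_atTop_eq_nat m]
  exact hF K hK u hu

theorem StronglyConverges.differentiable {G : ℕ → ℂ → ℂ} {φ : ℂ → ℂ} (hφ : StronglyConverges G φ)
    (hG : ∀ n, Differentiable ℂ (G n)) : Differentiable ℂ φ := by
  have hloc : TendstoLocallyUniformlyOn G φ atTop Set.univ :=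
    (tendstoLocallyUniformlyOn_iff_forall_isCompact isOpen_univ).2 fun K _ hK => hφ K hK
  exact differentiableOn_univ.1
    (hloc.differentiableOn (Eventually.of_forall fun n => (hG n).differentiableOn) isOpen_univ)

/-- Cauchy's estimates turn a bound on a disc of radius `2 * R` into a geometric majorant of the
Taylor series on the disc of radius `R`, which permits passing to the limit term by term. -/
theorem exists_represents_stronglyConverges_of_norm_le {G : ℕ → ℂ → ℂ}
    (hG : ∀ n, Differentiable ℂ (G n)) {f : PowerSeries ℂ}
    (hf : ∀ k, Tendsto (fun n => iteratedDeriv k (G n) 0) atTop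
      (𝓝 (k.factorial * PowerSeries.coeff k f)))
    (hbdd : ∀ R : ℝ, ∃ B, ∀ n z, ‖z‖ ≤ R → ‖G n z‖ ≤ B) :
    ∃ φ, Represents f φ ∧ StronglyConverges G φ := by
  set a : ℕ → ℕ → ℂ := fun n k => (k.factorial : ℂ)⁻¹ * iteratedDeriv k (G n) 0 with ha
  have hcoeff : ∀ k, Tendsto (fun n => a n k) atTop (𝓝 (PowerSeries.coeff k f)) := fun k => by
    have hk : (k.factorial : ℂ) ≠ 0 := Nat.cast_ne_zero.2 k.factorial_ne_zero
    simpa only [inv_mul_cancel_left₀ hk] using (hf k).const_mul (k.factorial : ℂ)⁻¹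
  have htaylor : ∀ n z, HasSum (fun k => a n k * z ^ k) (G n z) := fun n z => by
    simpa [ha, mul_assoc, mul_comm, mul_left_comm] using
      Complex.hasSum_taylorSeries_of_entire (hG n) 0 z
  have hmajorant : ∀ R : ℝ, 0 < R → ∃ bound : ℕ → ℝ, Summable bound ∧
      (∀ n k, ‖a n k‖ * R ^ k ≤ bound k) ∧ ∀ k, ‖PowerSeries.coeff k f‖ * R ^ k ≤ bound k := by
    intro R hR
    obtain ⟨B, hB⟩ := hbdd (2 * R)
    have hle : ∀ n k, ‖a n k‖ * R ^ k ≤ B * (1 / 2) ^ k := fun n k => by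
      have := norm_taylorCoeff_mul_pow_le (hG n) (by positivity) (hB n) k
      rw [mul_pow, mul_left_comm] at this
      rwa [one_div_pow, mul_one_div, le_div_iff₀' (by positivity)]
    exact ⟨_, summable_geometric_two.mul_left B, hle, fun k =>
      le_of_tendsto ((hcoeff k).norm.mul_const _) (Eventually.of_forall fun n => hle n k)⟩
  have hsummable : ∀ z : ℂ, Summable fun k => PowerSeries.coeff k f * z ^ k := fun z => by
    obtain ⟨bound, hbound, -, hle⟩ := hmajorant (‖z‖ + 1) (by positivity)
    refine hbound.of_norm_bounded fun k => (hle k).trans' ?_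
    rw [norm_mul, norm_pow]
    gcongr
    exact le_add_of_nonneg_right zero_le_one
  have hstrong : StronglyConverges G fun z => ∑' k, PowerSeries.coeff k f * z ^ k := by
    intro K hK
    obtain ⟨R, hR, hKR⟩ := hK.isBounded.exists_pos_norm_le
    obtain ⟨bound, hbound, hale, hle⟩ := hmajorant R hR
    exact (tendstoUniformlyOn_closedBall_of_coeff hbound hcoeff hale hle htaylor
      fun z => (hsummable z).hasSum).mono fun z hz => mem_closedBall_zero_iff.2 (hKR z hz)
  exact ⟨_, ⟨hstrong.differentiable hG, fun z => (hsummable z).hasSum⟩, hstrong⟩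

end CoefficientwiseConvergence

section BoundedPowerSums

theorem exists_norm_eval_le_of_hasInverseRoots {ι : Type*} (h : ℕ) (A M R : ℝ) (B : ℕ → ℝ) :
    ∃ D, ∀ (P : ℂ[X]) (b : ι →₀ ℂ), HasInverseRoots P b → ‖P.coeff 0‖ ≤ A →
      (∀ k, 0 < k → ‖powerSum b k‖ ≤ B k) → (∀ s : Finset ι, ∑ j ∈ s, ‖b j‖ ^ (h + 1) ≤ M) →
      ∀ z : ℂ, ‖z‖ ≤ R → ‖P.eval z‖ ≤ D := by
  obtain ⟨D, hD⟩ := exists_norm_canonicalProduct_le (ι := ι) h R M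
  refine ⟨A * (Real.exp (∑ k ∈ Finset.Icc 1 h, B k / k * R ^ k) * D),
    fun P b hb hA hB hM z hz => ?_⟩
  have hexponent : ‖-∑ k ∈ Finset.Icc 1 h, powerSum b k / k * z ^ k‖ ≤
      ∑ k ∈ Finset.Icc 1 h, B k / k * R ^ k := by
    rw [norm_neg]
    refine norm_sum_le_of_le _ fun k hk => ?_
    have hBk := hB k (Finset.mem_Icc.1 hk).1
    have hBk₀ : 0 ≤ B k := (norm_nonneg _).trans hBk
    rw [norm_mul, norm_div, norm_pow, Complex.norm_natCast]
    gcongr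
  rw [hb.eval_eq_exp_mul_canonicalProduct h, norm_mul, norm_mul]
  have hA₀ : 0 ≤ A := (norm_nonneg _).trans hA
  gcongr
  · exact (Complex.norm_exp_le_exp_norm _).trans (Real.exp_le_exp.2 hexponent)
  · exact hD b hM z hz

theorem WeaklyConverges.exists_represents_stronglyConverges {ι : Type*} {F : ℕ → ℂ[X]}
    {f : PowerSeries ℂ} (hF : WeaklyConverges F f) (hf : PowerSeries.coeff 0 f ≠ 0)
    {b : ℕ → ι →₀ ℂ} (hb : ∀ n, HasInverseRoots (F n) (b n)) {h : ℕ} {M : ℝ}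
    (hM : ∀ n (s : Finset ι), ∑ j ∈ s, ‖b n j‖ ^ (h + 1) ≤ M) :
    ∃ φ, Represents f φ ∧ StronglyConverges (fun n z => (F n).eval z) φ := by
  obtain ⟨A, hA⟩ := (hF.tendsto_coeff 0).norm.bddAbove_range
  choose! S hS using fun k =>
    HasInverseRoots.exists_tendsto_powerSum hb hF.tendsto_coeff hf (k := k)
  choose! B hB using fun k hk => (hS k hk).norm.bddAbove_range
  refine exists_represents_stronglyConverges_of_norm_le (fun n => (F n).differentiable) hF
    fun R => ?_
  obtain ⟨D, hD⟩ := exists_norm_eval_le_of_hasInverseRoots (ι := ι) h A M R B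
  exact ⟨D, fun n => hD _ _ (hb n) (hA (Set.mem_range_self n))
    (fun k hk => hB k hk (Set.mem_range_self n)) (hM n)⟩

theorem le_div_add_one_of_antitone {u : ℕ → ℝ} (hu : Antitone u) {M : ℝ}
    (hM : ∀ s : Finset ℕ, ∑ j ∈ s, u j ≤ M) (j : ℕ) : u j ≤ M / (j + 1) := by
  rw [le_div_iff₀' (by positivity)]
  calc ((j : ℝ) + 1) * u j = ∑ _i ∈ Finset.range (j + 1), u j := by simp
    _ ≤ ∑ i ∈ Finset.range (j + 1), u i :=
      Finset.sum_le_sum fun i hi => hu (Nat.lt_succ_iff.1 (Finset.mem_range.1 hi))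
    _ ≤ M := hM _

theorem norm_pow_succ_le_of_antitone {E : Type*} [SeminormedAddGroup E] {b : ℕ → E}
    (hb : Antitone fun j => ‖b j‖) {q : ℕ} (hq : q ≠ 0) {M : ℝ}
    (hM : ∀ s : Finset ℕ, ∑ j ∈ s, ‖b j‖ ^ q ≤ M) (j : ℕ) :
    ‖b j‖ ^ (q + 1) ≤ (M / (j + 1)) ^ ((q + 1 : ℝ) / q) := by
  have hanti : Antitone fun j => ‖b j‖ ^ q := fun _ _ hij =>
    pow_le_pow_left₀ (norm_nonneg _) (hb hij) q
  calc ‖b j‖ ^ (q + 1) = (‖b j‖ ^ q) ^ ((q + 1 : ℝ) / q) := by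
        rw [← Real.rpow_natCast_mul (norm_nonneg _), mul_div_cancel₀ _ (Nat.cast_ne_zero.2 hq)]
        exact_mod_cast (Real.rpow_natCast _ _).symm
    _ ≤ (M / (j + 1)) ^ ((q + 1 : ℝ) / q) :=
        Real.rpow_le_rpow (by positivity) (le_div_add_one_of_antitone hanti hM j) (by positivity)

theorem summable_div_add_one_rpow {M : ℝ} (hM : 0 ≤ M) {r : ℝ} (hr : 1 < r) :
    Summable fun j : ℕ => (M / (j + 1)) ^ r := by
  have h := (summable_nat_add_iff 1).2 (Real.summable_one_div_nat_rpow.2 hr)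
  refine (h.mul_left (M ^ r)).congr fun j => ?_
  rw [Real.div_rpow hM (by positivity), mul_one_div, Nat.cast_succ]

theorem exists_subseq_tendsto_of_mem_isCompact {κ X : Type*} [Countable κ] [TopologicalSpace X]
    [FirstCountableTopology X] {K : Set X} (hK : IsCompact K) {b : ℕ → κ → X}
    (hb : ∀ n j, b n j ∈ K) :
    ∃ (β : κ → X) (σ : ℕ → ℕ), StrictMono σ ∧ (∀ j, β j ∈ K) ∧
      ∀ j, Tendsto (fun n => b (σ n) j) atTop (𝓝 (β j)) := by
  obtain ⟨β, hβ, σ, hσ, hlim⟩ :=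
    (isCompact_univ_pi fun _ : κ => hK).tendsto_subseq fun n j _ => hb n j
  exact ⟨β, σ, hσ, fun j => hβ j (Set.mem_univ j), tendsto_pi_nhds.1 hlim⟩

/-- The bound `∑ j, ‖b n j‖ ^ (h + 1) ≤ M` gives no summable majorant of `‖b n j‖ ^ (h + 1)`, but
for decreasing moduli it gives one of `‖b n j‖ ^ (h + 2)`. Hence the rank `h + 1` in the limit,
although the limit satisfies the summability condition for rank `h`. -/
theorem exists_subseq_tendsto_canonicalProduct {T : Set ℂ} (hT : IsClosed T) {b : ℕ → ℕ → ℂ}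
    (hbT : ∀ n j, b n j ∈ T) (hanti : ∀ n, Antitone fun j => ‖b n j‖) {h : ℕ} {M : ℝ}
    (hM : ∀ n (s : Finset ℕ), ∑ j ∈ s, ‖b n j‖ ^ (h + 1) ≤ M) :
    ∃ (β : ℕ → ℂ) (σ : ℕ → ℕ), StrictMono σ ∧ (∀ j, β j ∈ T) ∧
      (Summable fun j => ‖β j‖ ^ (h + 1)) ∧
      ∀ z, Tendsto (fun n => canonicalProduct (h + 1) (b (σ n)) z) atTop
        (𝓝 (canonicalProduct (h + 1) β z)) := by
  have hM₀ : 0 ≤ M := by simpa using hM 0 ∅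
  obtain ⟨β, σ, hσ, hβ, hlim⟩ := exists_subseq_tendsto_of_mem_isCompact
    ((isCompact_closedBall (0 : ℂ) (M + 1)).inter_left hT) (b := b) fun n j =>
      ⟨hbT n j, mem_closedBall_zero_iff.2
        (norm_le_add_one_of_sum_norm_pow_le h.succ_ne_zero (hM n) j)⟩
  have hsummable : Summable fun j => ‖β j‖ ^ (h + 1) :=
    summable_of_sum_le (fun _ => by positivity) fun s =>
      le_of_tendsto (tendsto_finsetSum s fun j _ => (hlim j).norm.pow (h + 1))
        (Eventually.of_forall fun n => hM (σ n) s)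
  have hexponent : 1 < ((h + 1 : ℕ) + 1 : ℝ) / (h + 1 : ℕ) := by
    rw [lt_div_iff₀ (by positivity), one_mul]
    exact lt_add_one _
  exact ⟨β, σ, hσ, fun j => (hβ j).1, hsummable, tendsto_canonicalProduct
    (summable_div_add_one_rpow hM₀ hexponent)
    (fun n => norm_pow_succ_le_of_antitone (hanti (σ n)) h.succ_ne_zero (hM (σ n))) hlim⟩

theorem exists_natDegree_le_exp_eval_eq {c : ℂ} (hc : c ≠ 0) (q : ℕ) (S : ℕ → ℂ) :
    ∃ Q : ℂ[X], Q.natDegree ≤ q ∧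
      ∀ z, Complex.exp (Q.eval z) = c * Complex.exp (-∑ k ∈ Finset.Icc 1 q, S k * z ^ k) := by
  refine ⟨C (Complex.log c) - ∑ k ∈ Finset.Icc 1 q, C (S k) * X ^ k, ?_, fun z => ?_⟩
  · refine (natDegree_sub_le _ _).trans (max_le (by simp) ?_)
    exact natDegree_sum_le_of_forall_le _ _ fun k hk =>
      (natDegree_C_mul_X_pow_le _ _).trans (Finset.mem_Icc.1 hk).2
  · simp [sub_eq_add_neg, Complex.exp_add, Complex.exp_log hc, eval_finsetSum]

theorem WeaklyConverges.exists_eq_exp_mul_canonicalProduct {F : ℕ → ℂ[X]} {f : PowerSeries ℂ}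
    (hF : WeaklyConverges F f) (hf : PowerSeries.coeff 0 f ≠ 0) {φ : ℂ → ℂ}
    (hφ : ∀ z, Tendsto (fun n => (F n).eval z) atTop (𝓝 (φ z)))
    {b : ℕ → ℕ →₀ ℂ} (hb : ∀ n, HasInverseRoots (F n) (b n))
    (hanti : ∀ n, Antitone fun j => ‖b n j‖) {T : Set ℂ} (hT : IsClosed T)
    (hbT : ∀ n j, b n j ∈ T) {h : ℕ} {M : ℝ}
    (hM : ∀ n (s : Finset ℕ), ∑ j ∈ s, ‖b n j‖ ^ (h + 1) ≤ M) :
    ∃ (Q : ℂ[X]) (β : ℕ → ℂ), Q.natDegree ≤ h + 1 ∧ (∀ j, β j ∈ T) ∧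
      (Summable fun j => ‖β j‖ ^ (h + 1)) ∧
      ∀ z, φ z = Complex.exp (Q.eval z) * canonicalProduct (h + 1) β z := by
  choose! S hS using fun k =>
    HasInverseRoots.exists_tendsto_powerSum hb hF.tendsto_coeff hf (k := k)
  obtain ⟨β, σ, hσ, hβT, hβ, hlim⟩ := exists_subseq_tendsto_canonicalProduct hT hbT hanti hM
  obtain ⟨Q, hQdeg, hQ⟩ := exists_natDegree_le_exp_eval_eq hf (h + 1) fun k => S k / k
  refine ⟨Q, β, hQdeg, hβT, hβ, fun z => ?_⟩
  have hexp : Tendsto (fun n => Complex.exp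
      (-∑ k ∈ Finset.Icc 1 (h + 1), powerSum (b n) k / k * z ^ k)) atTop
      (𝓝 (Complex.exp (-∑ k ∈ Finset.Icc 1 (h + 1), S k / k * z ^ k))) :=
    (tendsto_finsetSum _ fun k hk =>
      ((hS k (Finset.mem_Icc.1 hk).1).div_const _).mul_const _).neg.cexp
  refine tendsto_nhds_unique ((hφ z).comp hσ.tendsto_atTop) ?_
  rw [hQ, mul_assoc]
  exact (((hF.tendsto_coeff 0).comp hσ.tendsto_atTop).mul
    ((hexp.comp hσ.tendsto_atTop).mul (hlim z))).congr fun n =>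
      ((hb (σ n)).eval_eq_exp_mul_canonicalProduct (h + 1) z).symm

end BoundedPowerSums

section RightHalfPlane

theorem isClosed_rightHalfPlaneRoot (p : ℕ) : IsClosed (rightHalfPlaneRoot p) :=
  isClosed_le continuous_const (Complex.continuous_re.comp (continuous_pow p))

theorem inv_mem_rightHalfPlaneRoot {p : ℕ} {z : ℂ} (hz : z ∈ rightHalfPlaneRoot p) :
    z⁻¹ ∈ rightHalfPlaneRoot p := by
  change 0 ≤ (z⁻¹ ^ p).re
  rw [inv_pow, Complex.inv_re]
  exact div_nonneg hz (Complex.normSq_nonneg _)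

theorem HasInverseRoots.mem_rightHalfPlaneRoot {ι : Type*} {P : ℂ[X]} {b : ι →₀ ℂ}
    (hb : HasInverseRoots P b) (hP : P ≠ 0) {p : ℕ} (hp : p ≠ 0)
    (hzeros : zeroSet (fun z => P.eval z) ⊆ rightHalfPlaneRoot p) (j : ι) :
    b j ∈ rightHalfPlaneRoot p := by
  rcases eq_or_ne (b j) 0 with hj | hj
  · simp [hj, rightHalfPlaneRoot, hp]
  · have hP' : (fun z => P.eval z) ≠ 0 := fun h =>
      hP (Polynomial.funext fun z => by simpa using congrFun h z)
    rw [← inv_inv (b j)]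
    exact inv_mem_rightHalfPlaneRoot (hzeros ⟨hP', hb.eval_inv_eq_zero hj⟩)

theorem zeroSet_exp_mul_canonicalProduct_subset {ι : Type*} {h p : ℕ} {β : ι → ℂ}
    (hβ : Summable fun j => ‖β j‖ ^ (h + 1)) (hβp : ∀ j, β j ∈ rightHalfPlaneRoot p)
    (u : ℂ → ℂ) :
    zeroSet (fun z => Complex.exp (u z) * canonicalProduct (h + 1) β z) ⊆
      rightHalfPlaneRoot p := by
  rintro z ⟨-, hz⟩
  obtain ⟨j, hj⟩ : ∃ j, z * β j = 1 := by
    by_contra! h₁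
    exact mul_ne_zero (Complex.exp_ne_zero _) (canonicalProduct_succ_ne_zero hβ h₁) hz
  rw [eq_inv_of_mul_eq_one_left hj]
  exact inv_mem_rightHalfPlaneRoot (hβp j)

theorem sum_norm_pow_two_mul_le {ι : Type*} {s : Finset ι} {b : ι → ℂ} {p : ℕ}
    (hb : ∀ j ∈ s, b j ∈ rightHalfPlaneRoot p) :
    ∑ j ∈ s, ‖b j‖ ^ (2 * p) ≤ 2 * ‖∑ j ∈ s, b j ^ p‖ ^ 2 + ‖∑ j ∈ s, b j ^ (2 * p)‖ := by
  have hnorm : ∀ j, ‖b j‖ ^ (2 * p) = 2 * (b j ^ p).re ^ 2 - (b j ^ (2 * p)).re := fun j => by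
    rw [mul_comm 2 p, pow_mul, ← norm_pow, pow_mul, Complex.sq_norm, Complex.normSq_apply,
      sq (b j ^ p), Complex.mul_re]
    ring
  have hsquares : ∑ j ∈ s, (b j ^ p).re ^ 2 ≤ ‖∑ j ∈ s, b j ^ p‖ ^ 2 := by
    calc ∑ j ∈ s, (b j ^ p).re ^ 2 ≤ (∑ j ∈ s, (b j ^ p).re) ^ 2 :=
          Finset.sum_sq_le_sq_sum_of_nonneg hb
      _ = |(∑ j ∈ s, b j ^ p).re| ^ 2 := by rw [sq_abs, Complex.re_sum]
      _ ≤ ‖∑ j ∈ s, b j ^ p‖ ^ 2 := by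
          gcongr
          exact Complex.abs_re_le_norm _
  have hre : -∑ j ∈ s, (b j ^ (2 * p)).re ≤ ‖∑ j ∈ s, b j ^ (2 * p)‖ := by
    rw [← Complex.re_sum]
    exact (neg_le_abs _).trans (Complex.abs_re_le_norm _)
  simp only [hnorm, Finset.sum_sub_distrib, ← Finset.mul_sum]
  linarith

theorem powerSum_eq_sum_of_support_subset {ι R : Type*} [CommRing R] {b : ι →₀ R} {s : Finset ι}
    (hs : b.support ⊆ s) {k : ℕ} (hk : k ≠ 0) : powerSum b k = ∑ j ∈ s, b j ^ k :=
  Finset.sum_subset hs fun j _ hj => by rw [Finsupp.notMem_support_iff.1 hj, zero_pow hk]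

theorem sum_norm_pow_two_mul_le_powerSum {ι : Type*} {b : ι →₀ ℂ} {p : ℕ} (hp : p ≠ 0)
    (hb : ∀ j, b j ∈ rightHalfPlaneRoot p) (s : Finset ι) :
    ∑ j ∈ s, ‖b j‖ ^ (2 * p) ≤ 2 * ‖powerSum b p‖ ^ 2 + ‖powerSum b (2 * p)‖ := by
  classical
  rw [powerSum_eq_sum_of_support_subset (Finset.subset_union_right (s₁ := s)) hp,
    powerSum_eq_sum_of_support_subset (Finset.subset_union_right (s₁ := s)) (by lia)]
  exact (Finset.sum_le_sum_of_subset_of_nonneg Finset.subset_union_left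
    fun _ _ _ => by positivity).trans (sum_norm_pow_two_mul_le fun j _ => hb j)

theorem WeaklyConverges.exists_sum_norm_pow_two_mul_le {ι : Type*} {F : ℕ → ℂ[X]}
    {f : PowerSeries ℂ} (hF : WeaklyConverges F f) (hf : PowerSeries.coeff 0 f ≠ 0)
    {b : ℕ → ι →₀ ℂ} (hb : ∀ n, HasInverseRoots (F n) (b n)) {p : ℕ} (hp : 0 < p)
    (hbp : ∀ n j, b n j ∈ rightHalfPlaneRoot p) :
    ∃ M, ∀ n (s : Finset ι), ∑ j ∈ s, ‖b n j‖ ^ (2 * p) ≤ M := by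
  obtain ⟨S, hS⟩ := HasInverseRoots.exists_tendsto_powerSum hb hF.tendsto_coeff hf hp
  obtain ⟨S', hS'⟩ :=
    HasInverseRoots.exists_tendsto_powerSum hb hF.tendsto_coeff hf (k := 2 * p) (by lia)
  obtain ⟨M, hM⟩ := (((hS.norm.pow 2).const_mul 2).add hS'.norm).bddAbove_range
  exact ⟨M, fun n s =>
    (sum_norm_pow_two_mul_le_powerSum hp.ne' (hbp n) s).trans (hM (Set.mem_range_self n))⟩

end RightHalfPlane

theorem differentiable_of_eq_exp_mul {φ u g : ℂ → ℂ} (hφ : Differentiable ℂ φ)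
    (hu : Differentiable ℂ u) (h : ∀ z, φ z = Complex.exp (u z) * g z) : Differentiable ℂ g := by
  have hg : g = fun z => Complex.exp (-u z) * φ z := by
    funext z
    rw [h, ← mul_assoc, ← Complex.exp_add, neg_add_cancel, Complex.exp_zero, one_mul]
  rw [hg]
  exact hu.neg.cexp.mul hφ

theorem theorem2p4 (p : ℕ) (hp : 0 < p) (F : ℕ → Polynomial ℂ) (f : PowerSeries ℂ)
    (hweak : WeaklyConverges F f)
    (c : ℂ) (hlim : Tendsto (fun n => (F n).eval 0) atTop (𝓝 c)) (hc : c ≠ 0)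
    (hzeros : ∀ n, zeroSet (fun z => (F n).eval z) ⊆ rightHalfPlaneRoot p) :
    ∃ φ : ℂ → ℂ, Represents f φ ∧
      StronglyConverges (fun n z => (F n).eval z) φ ∧
      zeroSet φ ⊆ rightHalfPlaneRoot p ∧
      ∃ (α : ℂ) (g : ℂ → ℂ), Differentiable ℂ g ∧ genus g ≤ ((2 * p - 1 : ℕ) : ℕ∞) ∧
        ∀ z : ℂ, φ z = Complex.exp (α * z ^ (2 * p)) * g z := by
  have hf : PowerSeries.coeff 0 f ≠ 0 := (hweak.coeff_zero_eq hlim).trans_ne hc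
  obtain ⟨m, hm⟩ := eventually_atTop.1 ((hweak.tendsto_coeff 0).eventually_ne hf)
  have hm' : ∀ n, (F (n + m)).coeff 0 ≠ 0 := fun n => hm _ (Nat.le_add_left m n)
  choose b hanti hb using fun n => exists_antitone_hasInverseRoots (hm' n)
  have hbp : ∀ n j, b n j ∈ rightHalfPlaneRoot p := fun n =>
    (hb n).mem_rightHalfPlaneRoot (fun h => hm' n (by rw [h, coeff_zero])) hp.ne' (hzeros _)
  have hweak' := hweak.comp_add m
  obtain ⟨M, hM⟩ := hweak'.exists_sum_norm_pow_two_mul_le hf hb hp hbp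
  obtain ⟨h, hph⟩ : ∃ h, 2 * p = h + 1 := ⟨2 * p - 1, by lia⟩
  simp only [hph, Nat.add_sub_cancel] at hM ⊢
  obtain ⟨φ, hrep, hstrong⟩ := hweak'.exists_represents_stronglyConverges hf hb hM
  obtain ⟨Q, β, hQ, hβp, hβ, hφ⟩ := hweak'.exists_eq_exp_mul_canonicalProduct hf hstrong.tendsto
    hb hanti (isClosed_rightHalfPlaneRoot p) hbp hM
  obtain ⟨α, g, hg, hφg⟩ := exists_exp_mul_hasHadamardProduct hβ hQ
  have hφg' : ∀ z, φ z = Complex.exp (α * z ^ (h + 1)) * g z := fun z => (hφ z).trans (hφg z)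
  refine ⟨φ, hrep, .of_add (m := m) hstrong, ?_, α, g, ?_, genus_le_of_hasHadamardProduct hg, hφg'⟩
  · rw [funext hφ]
    exact zeroSet_exp_mul_canonicalProduct_subset hβ hβp _
  · exact differentiable_of_eq_exp_mul hrep.1 (by fun_prop) hφg'
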